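/- \textbf{Model.} A market is given by the quality space $\mathcal Q=\{L,H\}=\{0,1\}$ with uniform prior $\pi_0$, a reward function $r(q,\theta)$, a feedback function $f(q,\theta,\varepsilon)$ with values in a finite set $\mathcal Z$, and the laws of a preference $\theta$ and of an independent noise $\varepsilon$, with $\mathbb E|r(q,\theta)|<\infty$ for $q\in\mathcal Q$. For $\eta\in(0,\frac12)$ let $Q_0=X_0$ and, independently at each step, $Q_{t+1}=X_{t+1}$ with probability $\eta$ and $Q_{t+1}=Q_t$ with probability $1-\eta$, where the $X_t$ are i.i.d. with law $\pi_0$. Let $(\theta_t)_t$ and $(\varepsilon_t)_t$ be i.i.d. copies of $\theta$ and $\varepsilon$; these sequences, the $X_t$ and the redraw coins are all independent. At each time $t\ge1$, consumer $t$ observes the history $\mathcal H_t=(Z_s)_{1\le s<t}$ and $\theta_t$, and buys if and only if $\mathbb E[r(Q_t,\theta_t)\mid\mathcal H_t,\theta_t]>0$. Then $Z_t=f(Q_t,\theta_t,\varepsilon_t)$ in case of purchase, and $Z_t=*\notin\mathcal Z$ otherwise. For a belief $\pi$ on $\mathcal Q$, $q\in\mathcal Q$ and $z\in\mathcal Z$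 put $$G(z,\pi,q)=\mathbb P_{\theta,\varepsilon}\big[\mathbb E_{q'\sim\pi}[r(q',\theta)]>0 \text{ and } f(q,\theta,\varepsilon)=z\big].$$ \textbf{Assumptions.} (i) $r(L,\theta)\le r(H,\theta)$ for all $\theta$, and $\mathbb P(r(L,\theta)>0)>0$. (ii) For every belief $\pi$, $G(z,\pi,q)>0$ for all $z\in\mathcal Z$ and $q\in\mathcal Q$, and $G(z,\pi,L)\ne G(z,\pi,H)$ for some $z\in\mathcal Z$. (iii) $\delta(L,H):=\inf_{\pi}\sum_{z\in\mathcal Z}|G(z,\pi,L)-G(z,\pi,H)|>0$. \textbf{Theorem.} Let $\mathcal L_T=\sum_{t=1}^T\mathbb E\big[\,\big|\mathbb E[Q_t\mid\mathcal H_t]-Q_t\big|\,\big]$. If $\eta T=\Omega(1)$, then $\mathcal L_T=\Theta(\ln(1/\eta)\,\eta\,T)$. That is, for every such market and every $c_0>0$ there are constants $c,C>0$, depending only on the market and on $c_0$, such that for all $\eta\in(0,\frac12)$ and all integers $T\ge1$ with $\eta T\ge c_0$, $$c\,\ln(1/\eta)\,\eta\,T\;\le\;\mathcal L_T\;\le\;C\,\ln(1/\eta)\,\eta\,T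 .$$ -/

import Mathlib

open MeasureTheory ProbabilityTheory

noncomputable section

namespace SocialLearning

/-- The binary quality space `{L, H} = {0, 1}`: `false` is `L` and `true` is `H`. -/
abbrev Quality := Bool

/-- The low quality `L`. -/
abbrev L : Quality := false

/-- The high quality `H`. -/
abbrev H : Quality := true

/-- The numerical value of a quality, `L = 0` and `H = 1`. -/
def value (q : Quality) : ℝ := if q then 1 else 0

/-- The law on `Bool` giving mass `p` to `true` and mass `1 - p` to `false`. -/
def coinLaw (p : ℝ) : Measure Bool :=
  ENNReal.ofReal p • Measure.dirac true + ENNReal.ofReal (1 - p) • Measure.dirac false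

/-- The uniform prior on `{L, H}`. -/
def prior : Measure Quality := coinLaw (1 / 2)

/-- The primitives of the market: the reward function `r`, the feedback function `f`, the law of
the preferences `θ_t` (in `Θ`) and the law of the noises `ε_t` (in `E`). The feedback space `F`
is finite in the sequel. -/
structure Market (Θ E F : Type*) [MeasurableSpace Θ] [MeasurableSpace E] where
  reward : Quality → Θ → ℝ
  feedback : Quality → Θ → E → F
  prefLaw : Measure Θ
  noiseLaw : Measure E
  prefLaw_prob : IsProbabilityMeasure prefLaw
  noiseLaw_prob : IsProbabilityMeasure noiseLaw
  reward_measurable : ∀ q, Measurable (reward q)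
  /-- The conditional expected utilities of the consumers are well defined. -/
  reward_integrable : ∀ q, Integrable (reward q) prefLaw
  feedback_measurable : ∀ q z, MeasurableSet {x : Θ × E | feedback q x.1 x.2 = z}

namespace Market

variable {Θ E F : Type*} [MeasurableSpace Θ] [MeasurableSpace E]

/-- Expected reward of a consumer with preference `θ` when `Q` is distributed according to the
belief `π` on `{L, H}` with `π(H) = p`. -/
def expectedReward (M : Market Θ E F) (p : ℝ) (θ : Θ) : ℝ :=
  (1 - p) * M.reward L θ + p * M.reward H θ

/-- `G(z, π, q)`, with `p = π(H)`: the probability that the consumer buys under the belief `π`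
and gives the feedback `z`, when the quality is `q`. -/
def G (M : Market Θ E F) (z : F) (p : ℝ) (q : Quality) : ℝ :=
  (M.prefLaw.prod M.noiseLaw).real
    {x : Θ × E | 0 < M.expectedReward p x.1 ∧ M.feedback q x.1 x.2 = z}

/-- Purchase guarantee: the reward is non-decreasing in the quality, and with positive probability
a consumer is ready to buy even the lowest quality. -/
def PurchaseGuarantee (M : Market Θ E F) : Prop :=
  (∀ θ, M.reward L θ ≤ M.reward H θ) ∧ 0 < M.prefLaw {θ | 0 < M.reward L θ}

/-- Identifiability: for every belief, all feedbacks have positive probability, and the two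
qualities induce different feedback probabilities. -/
def Identifiable (M : Market Θ E F) : Prop :=
  ∀ p ∈ Set.Icc (0 : ℝ) 1,
    (∀ z q, 0 < M.G z p q) ∧ ∃ z, M.G z p L ≠ M.G z p H

/-- `δ(L, H)`: the infimum, over all beliefs `π`, of `∑_z |G(z, π, L) - G(z, π, H)|`. -/
def delta [Fintype F] (M : Market Θ E F) : ℝ :=
  ⨅ p : Set.Icc (0 : ℝ) 1, ∑ z : F, |M.G z p L - M.G z p H|

end Market

/-- The random inputs of the dynamic model with redraw probability `η`, on a probability space
`(Ω, μ)`: at each time `t` a potential new quality `X t` with uniform law, a coin `S t` equal to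
`true` with probability `η`, a preference `θ t` and a noise `ε t`, all independent of each other
and independent across times. -/
structure Inputs {Θ E F : Type*} [MeasurableSpace Θ] [MeasurableSpace E]
    (M : Market Θ E F) (η : ℝ) {Ω : Type*} [MeasurableSpace Ω] (μ : Measure Ω) where
  X : ℕ → Ω → Quality
  S : ℕ → Ω → Bool
  θ : ℕ → Ω → Θ
  ε : ℕ → Ω → E
  X_measurable : ∀ t, Measurable (X t)
  S_measurable : ∀ t, Measurable (S t)
  θ_measurable : ∀ t, Measurable (θ t)
  ε_measurable : ∀ t, Measurable (ε t)
  law : ∀ t, μ.map (fun ω => (X t ω, S t ω, θ t ω, ε t ω)) =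
    prior.prod ((coinLaw η).prod (M.prefLaw.prod M.noiseLaw))
  indep : iIndepFun (fun t ω => (X t ω, S t ω, θ t ω, ε t ω)) μ

namespace Inputs

variable {Θ E F : Type*} [MeasurableSpace Θ] [MeasurableSpace E] {M : Market Θ E F} {η : ℝ}
  {Ω : Type*} [MeasurableSpace Ω] {μ : Measure Ω}

/-- The quality process: `Q_0 = X_0`, and `Q_{t+1}` is `X_{t+1}` if the coin of time `t + 1` says
so (probability `η`), and `Q_t` otherwise. -/
def Q (I : Inputs M η μ) : ℕ → Ω → Quality
  | 0 => I.X 0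
  | t + 1 => fun ω => if I.S (t + 1) ω then I.X (t + 1) ω else I.Q t ω

open Classical in
/-- The review `Z_t` for `t ≥ 1` (`none` stands for no purchase). Consumer `t` buys if and only if
the conditional expectation of `r(Q_t, θ_t)` given `Z_1, …, Z_{t-1}` and `θ_t` is positive, in
which case the review is `f(Q_t, θ_t, ε_t)`. -/
def review (I : Inputs M η μ) (t : ℕ) : Ω → Option F := fun ω =>
  if 0 < (μ[fun ω' => M.reward (I.Q t ω') (I.θ t ω') |
      (⨆ s : {s : ℕ // 1 ≤ s ∧ s < t}, MeasurableSpace.comap (I.review s.1) ⊤) ⊔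
        MeasurableSpace.comap (I.θ t) inferInstance]) ω
  then some (M.feedback (I.Q t ω) (I.θ t ω) (I.ε t ω))
  else none
termination_by t
decreasing_by exact s.2.2

/-- The information of the history `ℋ_t = (Z_s)_{1 ≤ s < t}`. -/
@[reducible] def history (I : Inputs M η μ) (t : ℕ) : MeasurableSpace Ω :=
  ⨆ s : {s : ℕ // 1 ≤ s ∧ s < t}, MeasurableSpace.comap (I.review s.1) ⊤

open Classical in
theorem review_eq (I : Inputs M η μ) (t : ℕ) (ω : Ω) :
    I.review t ω =
      if 0 < (μ[fun ω' => M.reward (I.Q t ω') (I.θ t ω') |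
          I.history t ⊔ MeasurableSpace.comap (I.θ t) inferInstance]) ω
      then some (M.feedback (I.Q t ω) (I.θ t ω) (I.ε t ω))
      else none := by
  rw [review]

/-- The cumulative loss `ℒ_T = ∑_{t=1}^T E[|E[Q_t | ℋ_t] - Q_t|]`. -/
def loss (I : Inputs M η μ) (T : ℕ) : ℝ :=
  ∑ t ∈ Finset.Icc 1 T,
    ∫ ω, ‖(μ[fun ω' => value (I.Q t ω') | I.history t]) ω - value (I.Q t ω)‖ ∂μ

end Inputs

end SocialLearning

end

/-! The potential is the mean posterior entropy of the current quality. For a belief `p`, the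
expected error of the posterior mean is `2p(1-p)`, so the loss is the sum of these errors along the
histories.

A redraw mixes the belief with the uniform law at rate `η`. It raises the entropy by at most `4η
log(1/η)` (`ent_redraw_le`) and, up to an error term, by at least `η log(1/η)/20`
(`ent_add_err_redraw_ge`). The correction is needed because beliefs near `1/2` gain no entropy;
there the error itself is large.

A review lowers the mean entropy by the mutual information between outcome and quality, which lies
between two constants times `p(1-p)` (`exists_posteriorEnt_bounds`). The lower constant comes from
`δ`, the upper one from a uniform lower bound on `G`.

The potential stays in `[0, log 2]`, so both balances telescope: up to constants, the total error
equals the total entropy injected by redraws. The initial `log 2` is absorbed through `ηT ≥ c₀`. -/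

noncomputable section

namespace SocialLearning

/-! ### Entropy and error of pairs of masses -/

/-- The entropy of a pair of masses: for `x + y = 1` the Shannon entropy of `(x, y)`, extended
homogeneously. -/
def ent (x y : ℝ) : ℝ := Real.negMulLog x + Real.negMulLog y - Real.negMulLog (x + y)

/-- The expected error of the posterior mean for a pair of masses. -/
def err (x y : ℝ) : ℝ := 2 * (x * y) / (x + y)

theorem ent_zero : ent 0 0 = 0 := by simp [ent]

theorem err_zero : err 0 0 = 0 := by simp [err]

theorem ent_comm (x y : ℝ) : ent x y = ent y x := by
  simp only [ent, add_comm y x]; ring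

/-- Homogeneity lets conditional entropies be summed over histories with unnormalised joint masses,
so null histories need no division. -/
theorem ent_mul (c x y : ℝ) : ent (c * x) (c * y) = c * ent x y := by
  simp only [ent, ← mul_add, Real.negMulLog_mul]; ring

theorem err_mul (c x y : ℝ) : err (c * x) (c * y) = c * err x y := by
  rcases eq_or_ne c 0 with rfl | hc
  · simp [err]
  · simp only [err, ← mul_add]
    rw [show 2 * (c * x * (c * y)) = c * (c * (2 * (x * y))) by ring, mul_div_mul_left _ _ hc,
      mul_div_assoc]

theorem ent_one_sub (p : ℝ) : ent p (1 - p) = Real.negMulLog p + Real.negMulLog (1 - p) := by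
  simp [ent]

theorem err_one_sub (p : ℝ) : err p (1 - p) = 2 * (p * (1 - p)) := by
  simp [err]

theorem ent_one_sub_eq_binEntropy (p : ℝ) : ent p (1 - p) = Real.binEntropy p := by
  rw [ent_one_sub, Real.binEntropy_eq_negMulLog_add_negMulLog_one_sub]

theorem exists_scale {x y : ℝ} (h : 0 < x + y) :
    x = (x + y) * (x / (x + y)) ∧ y = (x + y) * (1 - x / (x + y)) := by
  constructor
  · field_simp
  · field_simp
    ring

theorem ent_eq_scale {x y : ℝ} (h : 0 < x + y) :
    ent x y = (x + y) * ent (x / (x + y)) (1 - x / (x + y)) := by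
  obtain ⟨h1, h2⟩ := exists_scale h
  rw [← ent_mul, ← h1, ← h2]

theorem err_eq_scale {x y : ℝ} (h : 0 < x + y) :
    err x y = (x + y) * err (x / (x + y)) (1 - x / (x + y)) := by
  obtain ⟨h1, h2⟩ := exists_scale h
  rw [← err_mul, ← h1, ← h2]

theorem ent_nonneg {x y : ℝ} (hx : 0 ≤ x) (hy : 0 ≤ y) : 0 ≤ ent x y := by
  rcases (add_nonneg hx hy).eq_or_lt with h | h
  · obtain ⟨rfl, rfl⟩ : x = 0 ∧ y = 0 := by constructor <;> linarith
    rw [ent_zero]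
  · rw [ent_eq_scale h, ent_one_sub_eq_binEntropy]
    refine mul_nonneg h.le (Real.binEntropy_nonneg (by positivity) ?_)
    rw [div_le_one h]; linarith

theorem ent_le {x y : ℝ} (hx : 0 ≤ x) (hy : 0 ≤ y) : ent x y ≤ (x + y) * Real.log 2 := by
  rcases (add_nonneg hx hy).eq_or_lt with h | h
  · obtain ⟨rfl, rfl⟩ : x = 0 ∧ y = 0 := by constructor <;> linarith
    simp [ent_zero]
  · rw [ent_eq_scale h, ent_one_sub_eq_binEntropy]
    exact mul_le_mul_of_nonneg_left Real.binEntropy_le_log_two h.le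

theorem ent_half : ent (1 / 2) (1 / 2) = Real.log 2 := by
  have := ent_one_sub_eq_binEntropy (1 / 2)
  rw [show (1 : ℝ) - 1 / 2 = 1 / 2 by norm_num] at this
  rw [this, one_div, Real.binEntropy_two_inv]

/-! ### Information carried by one outcome -/

theorem mul_log_sub_log_le {x y : ℝ} (hx : 0 ≤ x) (hy : 0 < y) :
    x * (Real.log y - Real.log x) ≤ y - x := by
  rcases hx.eq_or_lt with rfl | hx
  · simpa using hy.le
  · have := Real.log_le_sub_one_of_pos (div_pos hy hx)
    rw [Real.log_div hy.ne' hx.ne'] at this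
    have h2 := mul_le_mul_of_nonneg_left this hx.le
    have : x * (y / x - 1) = y - x := by field_simp
    linarith

/-- The relative entropy dominates the squared distance. -/
theorem sq_sub_le_mul_log_sub_log {x y : ℝ} (hx : 0 < x) (hy : 0 < y) (hx1 : x ≤ 1) (hy1 : y ≤ 1) :
    x - y + (x - y) ^ 2 / 4 ≤ x * (Real.log x - Real.log y) := by
  -- Hellinger-type bound: with `x = a²` and `y = b²`, applying `log t ≤ t - 1` to `b / a` gives
  -- `2a(a - b) = x - y + (a - b)²`, and `a + b ≤ 2` bounds `(a - b)²` below by `(x - y)²/4`.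
  obtain ⟨a, ha, rfl⟩ : ∃ a, 0 < a ∧ x = a ^ 2 := ⟨√x, by positivity, by rw [Real.sq_sqrt hx.le]⟩
  obtain ⟨b, hb, rfl⟩ : ∃ b, 0 < b ∧ y = b ^ 2 := ⟨√y, by positivity, by rw [Real.sq_sqrt hy.le]⟩
  have ha1 : a ≤ 1 := by nlinarith
  have hb1 : b ≤ 1 := by nlinarith
  have h := mul_log_sub_log_le ha.le hb
  rw [Real.log_pow, Real.log_pow]
  push_cast
  have h1 := mul_le_mul_of_nonneg_left h ha.le
  have h2 : (a ^ 2 - b ^ 2) ^ 2 ≤ 4 * (a - b) ^ 2 := by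
    have h4 : (a + b) ^ 2 ≤ 4 := by nlinarith
    have := mul_le_mul_of_nonneg_right h4 (sq_nonneg (a - b))
    nlinarith
  nlinarith

/-- The subtracted bracket is the contribution of one outcome to the mutual information: relative
entropies of `g` and `k` against their mixture. -/
theorem ent_posterior_eq (p g k : ℝ) :
    ent (p * g) ((1 - p) * k) =
      g * Real.negMulLog p + k * Real.negMulLog (1 - p) -
        (p * (g * (Real.log g - Real.log (p * g + (1 - p) * k))) +
          (1 - p) * (k * (Real.log k - Real.log (p * g + (1 - p) * k)))) := by
  simp only [ent, Real.negMulLog_mul]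
  simp only [Real.negMulLog]
  ring

/-- Information gained from an outcome of probabilities `g` and `k`, from below. -/
theorem ent_posterior_le {p g k : ℝ} (hp0 : 0 < p) (hp1 : p < 1) (hg : 0 < g) (hk : 0 < k)
    (hg1 : g ≤ 1) (hk1 : k ≤ 1) :
    ent (p * g) ((1 - p) * k) ≤ g * Real.negMulLog p + k * Real.negMulLog (1 - p) -
      (g - k) ^ 2 / 4 * (p * (1 - p)) := by
  rw [ent_posterior_eq]
  have hq : 0 < 1 - p := by linarith
  set w := p * g + (1 - p) * k with hw
  have hw0 : 0 < w := by positivity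
  have hw1 : w ≤ 1 := by nlinarith
  have h1 := mul_le_mul_of_nonneg_left (sq_sub_le_mul_log_sub_log hg hw0 hg1 hw1) hp0.le
  have h2 := mul_le_mul_of_nonneg_left (sq_sub_le_mul_log_sub_log hk hw0 hk1 hw1) hq.le
  -- The linear terms cancel because `w` is the mean of `g` and `k`; the squares form the variance
  -- `p(1-p)(g-k)²`.
  have h3 : p * (g - w + (g - w) ^ 2 / 4) + (1 - p) * (k - w + (k - w) ^ 2 / 4) =
      (g - k) ^ 2 / 4 * (p * (1 - p)) := by
    rw [hw]; ring
  linarith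

/-- Information gained from an outcome of probabilities `g` and `k`, from above. -/
theorem le_ent_posterior {p g k γ : ℝ} (hp0 : 0 < p) (hp1 : p < 1) (hγ : 0 < γ) (hg : γ ≤ g)
    (hk : γ ≤ k) :
    g * Real.negMulLog p + k * Real.negMulLog (1 - p) - (g - k) ^ 2 / γ * (p * (1 - p)) ≤
      ent (p * g) ((1 - p) * k) := by
  rw [ent_posterior_eq]
  have hq : 0 < 1 - p := by linarith
  have hg0 : 0 < g := by linarith
  have hk0 : 0 < k := by linarith
  set w := p * g + (1 - p) * k with hw
  have hw0 : 0 < w := by positivity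
  have hγw : γ ≤ w := by nlinarith
  -- Chi-squared bound on the relative entropy; its denominator `w` is then replaced by `γ`.
  have key : ∀ x : ℝ, 0 < x → x * (Real.log x - Real.log w) ≤ x * ((x - w) / w) := fun x hx => by
    refine mul_le_mul_of_nonneg_left ?_ hx.le
    rw [← Real.log_div hx.ne' hw0.ne', sub_div, div_self hw0.ne']
    exact Real.log_le_sub_one_of_pos (div_pos hx hw0)
  have h1 := mul_le_mul_of_nonneg_left (key g hg0) hp0.le
  have h2 := mul_le_mul_of_nonneg_left (key k hk0) hq.le
  have h3 : p * (g * ((g - w) / w)) + (1 - p) * (k * ((k - w) / w)) =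
      (g - k) ^ 2 / w * (p * (1 - p)) := by
    field_simp
    rw [hw]; ring
  have h4 : (g - k) ^ 2 / w * (p * (1 - p)) ≤ (g - k) ^ 2 / γ * (p * (1 - p)) := by
    gcongr
  linarith

theorem ent_posterior_self (p g : ℝ) :
    ent (p * g) ((1 - p) * g) = g * Real.negMulLog p + g * Real.negMulLog (1 - p) := by
  rw [mul_comm p, mul_comm (1 - p), ent_mul, ent_one_sub]; ring

/-! ### Entropy created by a redraw -/

theorem negMulLog_add_le {x y : ℝ} (hx : 0 ≤ x) (hy : 0 ≤ y) :
    Real.negMulLog (x + y) ≤ Real.negMulLog x + Real.negMulLog y := by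
  have := ent_nonneg hx hy
  simp only [ent] at this
  linarith

theorem negMulLog_one_sub_le {η : ℝ} (h1 : η < 1) :
    Real.negMulLog (1 - η) ≤ η := by
  have := mul_log_sub_log_le (x := 1 - η) (y := 1) (by linarith) one_pos
  simp only [Real.negMulLog, Real.log_one] at *
  linarith

theorem log_two_le_log_inv {η : ℝ} (h0 : 0 < η) (h1 : η < 1 / 2) :
    Real.log 2 ≤ Real.log (1 / η) := by
  apply Real.log_le_log two_pos
  rw [le_div_iff₀ h0]; linarith

theorem half_lt_log_inv {η : ℝ} (h0 : 0 < η) (h1 : η < 1 / 2) : 1 / 2 < Real.log (1 / η) := by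
  have := log_two_le_log_inv h0 h1
  have := Real.log_two_gt_d9
  linarith

/-- A redraw of probability `η` increases the entropy by at most the order of `η log (1 / η)`. -/
theorem ent_redraw_le {η p : ℝ} (h0 : 0 < η) (h1 : η < 1 / 2) (hp0 : 0 ≤ p) (hp1 : p ≤ 1) :
    ent ((1 - η) * p + η / 2) (1 - ((1 - η) * p + η / 2)) ≤
      ent p (1 - p) + 4 * (η * Real.log (1 / η)) := by
  have hq : 0 ≤ 1 - p := by linarith
  have e1 := negMulLog_add_le (mul_nonneg (by linarith : (0 : ℝ) ≤ 1 - η) hp0)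
    (by positivity : 0 ≤ η / 2)
  have e2 := negMulLog_add_le (mul_nonneg (by linarith : (0 : ℝ) ≤ 1 - η) hq)
    (by positivity : 0 ≤ η / 2)
  have hE := ent_nonneg hp0 hq
  have e3 := negMulLog_one_sub_le (η := η) (by linarith)
  have e4 := log_two_le_log_inv h0 h1
  have e5 := half_lt_log_inv h0 h1
  have e6 : Real.negMulLog (η / 2) = η / 2 * (Real.log (1 / η) + Real.log 2) := by
    rw [Real.negMulLog, Real.log_div h0.ne' two_ne_zero, one_div, Real.log_inv]; ring
  rw [ent_one_sub,
    show 1 - ((1 - η) * p + η / 2) = (1 - η) * (1 - p) + η / 2 by ring]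
  rw [ent_one_sub] at hE ⊢
  rw [Real.negMulLog_mul] at e1 e2
  -- The fresh mass `η/2` on each side costs `η (log(1/η) + log 2) ≤ 2η log(1/η)`, and the factor `1
  -- - η` costs at most `η ≤ 2η log(1/η)`; hence the constant 4.
  nlinarith

/-- Concavity: the tangent at `r`, of slope `log((1-r)/r)`, lies above the entropy (Gibbs'
inequality in both coordinates). -/
theorem ent_sub_ent_ge {p r : ℝ} (hp0 : 0 ≤ p) (hp1 : p ≤ 1) (hr0 : 0 < r) (hr1 : r < 1) :
    (r - p) * (Real.log (1 - r) - Real.log r) ≤ ent r (1 - r) - ent p (1 - p) := by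
  have h1 := mul_log_sub_log_le hp0 hr0
  have h2 := mul_log_sub_log_le (sub_nonneg.2 hp1) (sub_pos.2 hr1)
  simp only [ent_one_sub, Real.negMulLog]
  linarith

theorem ent_add_err_redraw_ge_of_le_half {η p : ℝ} (h0 : 0 < η) (h1 : η < 1 / 2) (hp0 : 0 ≤ p)
    (hp1 : p ≤ 1 / 2) :
    ent p (1 - p) + 1 / 20 * (η * Real.log (1 / η)) ≤
      ent ((1 - η) * p + η / 2) (1 - ((1 - η) * p + η / 2)) +
        ((1 - η) * p + η / 2) * (1 - ((1 - η) * p + η / 2)) := by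
  set r := (1 - η) * p + η / 2 with hr
  have hrp : r - p = η * (1 / 2 - p) := by rw [hr]; ring
  have hpr : p ≤ r := by nlinarith
  have hr2 : r ≤ 1 / 2 := by nlinarith
  have hr0 : 0 < r := by nlinarith
  have hT := ent_sub_ent_ge hp0 (by linarith : p ≤ 1) hr0 (by linarith)
  obtain ⟨s, hs, hs2⟩ : ∃ s, 0 < s ∧ η = s ^ 2 :=
    ⟨√η, by positivity, by rw [Real.sq_sqrt h0.le]⟩
  have hs1 : s < 0.71 := by nlinarith
  have hlog : Real.log (1 / η) = 2 * Real.log (1 / s) := by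
    rw [hs2, one_div, one_div, Real.log_inv, Real.log_inv, Real.log_pow]; push_cast; ring
  have hls : 0 ≤ Real.log (1 / s) := Real.log_nonneg (by rw [le_div_iff₀ hs]; linarith)
  -- Threshold at order `s = √η`. Below it the slope of the entropy is at least `log(1/η)/2` and `p`
  -- is bounded away from `1/2`, so the entropy gain suffices. Above it the error `r(1-r) ≥ s/4`
  -- dominates `η log(1/η) ≤ 2s`.
  rcases le_or_gt r (s / 2) with hc | hc
  · have hl : Real.log (1 / s) ≤ Real.log (1 - r) - Real.log r := by
      rw [← Real.log_div (by linarith) hr0.ne']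
      apply Real.log_le_log (by positivity)
      rw [div_le_div_iff₀ hs hr0]
      nlinarith
    have h3 : η * 0.14 * Real.log (1 / s) ≤ (r - p) * (Real.log (1 - r) - Real.log r) := by
      rw [hrp]
      have : (0.14 : ℝ) ≤ 1 / 2 - p := by linarith
      gcongr
    have : 0 ≤ r * (1 - r) := by nlinarith
    rw [hlog]
    nlinarith [mul_nonneg h0.le hls]
  · have h3 : 0 ≤ (r - p) * (Real.log (1 - r) - Real.log r) := by
      apply mul_nonneg (by linarith)
      have := Real.log_le_log hr0 (by linarith : r ≤ 1 - r)
      linarith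
    have h4 : s * Real.log (1 / s) ≤ 1 := by
      have := mul_log_sub_log_le hs.le one_pos
      rw [one_div, Real.log_inv]
      rw [Real.log_one] at this
      linarith
    have h5 : η * Real.log (1 / η) ≤ 2 * s := by
      rw [hlog, hs2]; nlinarith
    have h6 : s / 4 ≤ r * (1 - r) := by nlinarith
    linarith

/-- A redraw of probability `η` increases the entropy by at least the order of `η log (1 / η)`,
up to the error after the redraw. -/
theorem ent_add_err_redraw_ge {η p : ℝ} (h0 : 0 < η) (h1 : η < 1 / 2) (hp0 : 0 ≤ p)
    (hp1 : p ≤ 1) :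
    ent p (1 - p) + 1 / 20 * (η * Real.log (1 / η)) ≤
      ent ((1 - η) * p + η / 2) (1 - ((1 - η) * p + η / 2)) +
        ((1 - η) * p + η / 2) * (1 - ((1 - η) * p + η / 2)) := by
  rcases le_total p (1 / 2) with h | h
  · exact ent_add_err_redraw_ge_of_le_half h0 h1 hp0 h
  · have := ent_add_err_redraw_ge_of_le_half h0 h1 (sub_nonneg.2 hp1) (by linarith)
    rw [show (1 - η) * (1 - p) + η / 2 = 1 - ((1 - η) * p + η / 2) by ring, sub_sub_cancel,
      sub_sub_cancel, ent_comm (1 - p), ent_comm (1 - _)] at this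
    linarith

/-- The pair of masses after a redraw of probability `η`. -/
def redraw (η x y : ℝ) : ℝ := (1 - η) * x + η / 2 * (x + y)

theorem redraw_scale {x y : ℝ} (η : ℝ) (h : 0 < x + y) :
    redraw η x y = (x + y) * ((1 - η) * (x / (x + y)) + η / 2) ∧
      redraw η y x = (x + y) * (1 - ((1 - η) * (x / (x + y)) + η / 2)) := by
  constructor
  · simp only [redraw]
    field_simp
  · simp only [redraw]
    field_simp
    ring

theorem ent_redraw_bounds {η x y : ℝ} (h0 : 0 < η) (h1 : η < 1 / 2) (hx : 0 ≤ x) (hy : 0 ≤ y) :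
    ent (redraw η x y) (redraw η y x) ≤ ent x y + (x + y) * (4 * (η * Real.log (1 / η))) ∧
      ent x y + (x + y) * (1 / 20 * (η * Real.log (1 / η))) ≤
        ent (redraw η x y) (redraw η y x) + err (redraw η x y) (redraw η y x) := by
  rcases (add_nonneg hx hy).eq_or_lt with h | h
  · obtain ⟨rfl, rfl⟩ : x = 0 ∧ y = 0 := by constructor <;> linarith
    simp [redraw, ent_zero, err_zero]
  · obtain ⟨r1, r2⟩ := redraw_scale η h
    have hex := ent_eq_scale h
    set p := x / (x + y) with hp
    set m := x + y with hm
    have hp0 : 0 ≤ p := by positivity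
    have hp1 : p ≤ 1 := by rw [hp, div_le_one h]; linarith
    rw [r1, r2, ent_mul, err_mul, err_one_sub, hex]
    have k1 := mul_le_mul_of_nonneg_left (ent_redraw_le h0 h1 hp0 hp1) h.le
    have k2 := mul_le_mul_of_nonneg_left (ent_add_err_redraw_ge h0 h1 hp0 hp1) h.le
    set r := (1 - η) * p + η / 2 with hr
    have : 0 ≤ m * (r * (1 - r)) := by
      have : 0 ≤ r := by nlinarith
      have : 0 ≤ 1 - r := by nlinarith
      positivity
    constructor <;> linarith

theorem redraw_pos {η x y : ℝ} (h0 : 0 < η) (h1 : η < 1 / 2) (hx : 0 ≤ x)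
    (h : 0 < x + y) : 0 < redraw η x y := by
  have : 0 ≤ 1 - η := by linarith
  unfold redraw; positivity

/-! ### Conditioning on a variable with finitely many values -/

theorem iUnion_atom {Ω α : Type*} (W : Ω → α) (q : Ω → Bool) (s : Set Ω) :
    ⋃ i : α × Bool, s ∩ {ω | W ω = i.1 ∧ q ω = i.2} = s := by
  ext ω
  simp

theorem disjoint_atom {Ω α : Type*} (W : Ω → α) (q : Ω → Bool) (s : Set Ω) :
    Pairwise (Function.onFun Disjoint fun i : α × Bool => s ∩ {ω | W ω = i.1 ∧ q ω = i.2}) := by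
  intro i j hij
  rw [Function.onFun, Set.disjoint_left]
  rintro ω ⟨-, h1, h2⟩ ⟨-, h3, h4⟩
  exact hij (Prod.ext (h1.symm.trans h3) (h2.symm.trans h4))

section FiniteConditioning

variable {Ω α Θ : Type*} [MeasurableSpace Ω] {μ : Measure Ω} [MeasurableSpace Θ]
  {ν : Measure Θ}

/-- The joint law of a random variable `W` and a quality `q`. -/
def jointMass (μ : Measure Ω) (W : Ω → α) (q : Ω → Bool) (h : α) (b : Bool) : ℝ :=
  μ.real {ω | W ω = h ∧ q ω = b}

/-- The conditional probability of `H` given `W = h`. -/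
def jointBelief (μ : Measure Ω) (W : Ω → α) (q : Ω → Bool) (h : α) : ℝ :=
  jointMass μ W q h true / (jointMass μ W q h true + jointMass μ W q h false)

theorem jointMass_nonneg (W : Ω → α) (q : Ω → Bool) (h : α) (b : Bool) :
    0 ≤ jointMass μ W q h b := measureReal_nonneg

/-- Also valid on null atoms, where both masses vanish and the belief takes the default value of a
division by zero. -/
theorem jointBelief_mul (W : Ω → α) (q : Ω → Bool) (h : α) :
    jointMass μ W q h true = (jointMass μ W q h true + jointMass μ W q h false) *
      jointBelief μ W q h ∧
    jointMass μ W q h false = (jointMass μ W q h true + jointMass μ W q h false) *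
      (1 - jointBelief μ W q h) := by
  have h1 := jointMass_nonneg (μ := μ) W q h true
  have h2 := jointMass_nonneg (μ := μ) W q h false
  rcases (add_nonneg h1 h2).eq_or_lt with h | h
  · rw [← h]
    constructor <;> linarith
  · exact exists_scale h

theorem jointBelief_mem (W : Ω → α) (q : Ω → Bool) (h : α) :
    jointBelief μ W q h ∈ Set.Icc (0 : ℝ) 1 := by
  have h1 := jointMass_nonneg (μ := μ) W q h true
  have h2 := jointMass_nonneg (μ := μ) W q h false
  exact ⟨by unfold jointBelief; positivity, div_le_one_of_le₀ (by linarith) (by positivity)⟩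

variable {W : Ω → α} {q : Ω → Bool} {θ : Ω → Θ}

theorem measurableSet_atom (hW : ∀ h, MeasurableSet (W ⁻¹' {h})) (hq : Measurable q)
    (i : α × Bool) : MeasurableSet {ω | W ω = i.1 ∧ q ω = i.2} :=
  (hW i.1).inter (hq (measurableSet_singleton i.2))

section

/-- `θ` is independent of the pair `(W, q)` and has law `ν`. -/
def IndepOfAtoms (μ : Measure Ω) (ν : Measure Θ) (W : Ω → α) (q : Ω → Bool) (θ : Ω → Θ) : Prop :=
  ∀ h b B, MeasurableSet B →
    μ.real ({ω | W ω = h ∧ q ω = b} ∩ θ ⁻¹' B) = jointMass μ W q h b * ν.real B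

variable [IsProbabilityMeasure μ] [IsProbabilityMeasure ν]

theorem map_restrict_atom (hθ : Measurable θ) (hind : IndepOfAtoms μ ν W q θ) (h : α) (b : Bool) :
    (μ.restrict {ω | W ω = h ∧ q ω = b}).map θ = μ {ω | W ω = h ∧ q ω = b} • ν := by
  ext B hB
  have := hind h b B hB
  rw [Measure.map_apply hθ hB, Measure.restrict_apply (hθ hB), Set.inter_comm,
    Measure.smul_apply, smul_eq_mul, ← ENNReal.toReal_eq_toReal_iff' (by finiteness)
    (by finiteness), ENNReal.toReal_mul]
  exact this

theorem integrableOn_atom (hθ : Measurable θ) (hind : IndepOfAtoms μ ν W q θ) (h : α) (b : Bool)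
    {F : Θ → ℝ} (hF : Integrable F ν) :
    IntegrableOn (fun ω => F (θ ω)) {ω | W ω = h ∧ q ω = b} μ := by
  have : Integrable F ((μ.restrict {ω | W ω = h ∧ q ω = b}).map θ) := by
    rw [map_restrict_atom hθ hind]
    exact hF.smul_measure (by finiteness)
  exact this.comp_measurable hθ

theorem setIntegral_atom (hθ : Measurable θ) (hind : IndepOfAtoms μ ν W q θ) (h : α) (b : Bool)
    {F : Θ → ℝ} (hF : Integrable F ν) {B : Set Θ} (hB : MeasurableSet B) :
    ∫ ω in θ ⁻¹' B ∩ {ω | W ω = h ∧ q ω = b}, F (θ ω) ∂μ =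
      jointMass μ W q h b * ∫ x in B, F x ∂ν := by
  rw [← Measure.restrict_restrict (hθ hB)]
  have hint : AEStronglyMeasurable F ((μ.restrict {ω | W ω = h ∧ q ω = b}).map θ) := by
    rw [map_restrict_atom hθ hind]
    exact (hF.smul_measure (by finiteness)).aestronglyMeasurable
  rw [← setIntegral_map hB hint hθ.aemeasurable, map_restrict_atom hθ hind,
    Measure.restrict_smul, integral_smul_measure, smul_eq_mul]
  rfl

end

variable [Fintype α]

theorem setIntegral_eq_sum_atom (hW : ∀ h, MeasurableSet (W ⁻¹' {h})) (hq : Measurable q)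
    {f : Ω → ℝ} {s : Set Ω} (hs : MeasurableSet s) (hf : Integrable f μ) :
    ∫ ω in s, f ω ∂μ =
      ∑ i : α × Bool, ∫ ω in s ∩ {ω | W ω = i.1 ∧ q ω = i.2}, f ω ∂μ := by
  rw [← integral_iUnion_fintype (fun i => hs.inter (measurableSet_atom hW hq i))
    (disjoint_atom W q s) (fun i => hf.integrableOn), iUnion_atom]

variable [IsProbabilityMeasure μ]

theorem sum_jointMass (hW : ∀ h, MeasurableSet (W ⁻¹' {h})) (hq : Measurable q) :
    ∑ h, (jointMass μ W q h true + jointMass μ W q h false) = 1 := by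
  have h := setIntegral_eq_sum_atom (μ := μ) hW hq MeasurableSet.univ (integrable_const (1 : ℝ))
  simp only [Set.univ_inter, setIntegral_const, smul_eq_mul, mul_one, Fintype.sum_prod_type,
    Fintype.sum_bool] at h
  simpa [jointMass] using h.symm

/-- The mean of a function of `W` and of the quality. -/
theorem integral_eq_sum_jointMass (hW : ∀ h, MeasurableSet (W ⁻¹' {h})) (hq : Measurable q)
    (F : α → Bool → ℝ) :
    ∫ ω, F (W ω) (q ω) ∂μ =
      ∑ h, (jointMass μ W q h true * F h true + jointMass μ W q h false * F h false) := by
  have hF : Integrable (fun ω => F (W ω) (q ω)) μ := by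
    have hm : Measurable fun ω => F (W ω) (q ω) := by
      let _ : MeasurableSpace α := ⊤
      have : MeasurableSingletonClass α := ⟨fun _ => trivial⟩
      have h1 : Measurable W := measurable_to_countable' hW
      exact (measurable_of_finite fun i : α × Bool => F i.1 i.2).comp (h1.prodMk hq)
    refine Integrable.of_bound hm.aestronglyMeasurable (∑ h, ∑ b, ‖F h b‖)
      (Filter.Eventually.of_forall fun ω => ?_)
    exact (Finset.single_le_sum (f := fun b => ‖F (W ω) b‖) (fun _ _ => norm_nonneg _)
      (Finset.mem_univ (q ω))).trans (Finset.single_le_sum (f := fun h => ∑ b, ‖F h b‖)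
        (fun _ _ => Finset.sum_nonneg fun _ _ => norm_nonneg _) (Finset.mem_univ (W ω)))
  have h := setIntegral_eq_sum_atom (μ := μ) hW hq MeasurableSet.univ hF
  rw [setIntegral_univ] at h
  rw [h, Fintype.sum_prod_type]
  refine Finset.sum_congr rfl fun a _ => ?_
  rw [Fintype.sum_bool]
  have key : ∀ b, ∫ ω in Set.univ ∩ {ω | W ω = a ∧ q ω = b}, F (W ω) (q ω) ∂μ =
      jointMass μ W q a b * F a b := fun b => by
    rw [Set.univ_inter, setIntegral_congr_fun (g := fun _ => F a b)
      (measurableSet_atom hW hq (a, b)) (fun ω hω => by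
        obtain ⟨h1, h2⟩ := hω
        simp only [h1, h2]), setIntegral_const, smul_eq_mul, jointMass]
  rw [key, key]

variable [IsProbabilityMeasure ν]

theorem integrable_of_atoms (hW : ∀ h, MeasurableSet (W ⁻¹' {h})) (hq : Measurable q)
    (hθ : Measurable θ) (hind : IndepOfAtoms μ ν W q θ) {F : α → Bool → Θ → ℝ}
    (hF : ∀ h b, Integrable (F h b) ν) :
    Integrable (fun ω => F (W ω) (q ω) (θ ω)) μ := by
  rw [← integrableOn_univ, ← iUnion_atom W q Set.univ]
  refine integrableOn_finite_iUnion.2 fun i => ?_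
  rw [Set.univ_inter]
  refine (integrableOn_atom hθ hind i.1 i.2 (hF i.1 i.2)).congr_fun (fun ω hω => ?_)
    (measurableSet_atom hW hq i)
  obtain ⟨h1, h2⟩ := hω
  simp only [h1, h2]

/-- Bayes' rule: the conditional mean of `g q θ` given `W` and `θ`. -/
theorem condExp_eq_of_indepOfAtoms (hW : ∀ h, MeasurableSet (W ⁻¹' {h})) (hq : Measurable q)
    (hθ : Measurable θ) (hind : IndepOfAtoms μ ν W q θ) {g : Bool → Θ → ℝ}
    (hgm : ∀ b, Measurable (g b)) (hg : ∀ b, Integrable (g b) ν) :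
    (fun ω => (1 - jointBelief μ W q (W ω)) * g false (θ ω) +
        jointBelief μ W q (W ω) * g true (θ ω)) =ᵐ[μ]
      μ[fun ω => g (q ω) (θ ω) |
        MeasurableSpace.comap W ⊤ ⊔ MeasurableSpace.comap θ inferInstance] := by
  let _ : MeasurableSpace α := ⊤
  have hsing : MeasurableSingletonClass α := ⟨fun _ => trivial⟩
  have hWm : Measurable W := measurable_to_countable' hW
  have hWθ : Measurable fun ω => (W ω, θ ω) := hWm.prodMk hθ
  have hm : MeasurableSpace.comap W ⊤ ⊔ MeasurableSpace.comap θ inferInstance =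
      MeasurableSpace.comap (fun ω => (W ω, θ ω)) inferInstance := by
    exact (MeasurableSpace.comap_prodMk W θ).symm
  rw [hm]
  -- The dummy quality argument gives both sides the same form, so one computation on atoms covers
  -- them.
  let F : α → Bool → Θ → ℝ := fun h _ x =>
    (1 - jointBelief μ W q h) * g false x + jointBelief μ W q h * g true x
  have hF : ∀ h b, Integrable (F h b) ν := fun h b =>
    ((hg false).const_mul _).add ((hg true).const_mul _)
  have hFi : Integrable (fun ω => F (W ω) (q ω) (θ ω)) μ := integrable_of_atoms hW hq hθ hind hF
  have hgi : Integrable (fun ω => g (q ω) (θ ω)) μ :=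
    integrable_of_atoms (F := fun _ => g) hW hq hθ hind fun _ => hg
  refine ae_eq_condExp_of_forall_setIntegral_eq hWθ.comap_le hgi
    (fun s _ _ => hFi.integrableOn) ?_ ?_
  · rintro s ⟨B, hB, rfl⟩ -
    have hs : MeasurableSet ((fun ω => (W ω, θ ω)) ⁻¹' B) := hWθ hB
    have e1 := setIntegral_eq_sum_atom hW hq hs hFi
    have e2 := setIntegral_eq_sum_atom hW hq hs hgi
    refine e1.trans (Eq.trans ?_ e2.symm)
    rw [Fintype.sum_prod_type, Fintype.sum_prod_type]
    refine Finset.sum_congr rfl fun h _ => ?_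
    have hBh : MeasurableSet (Prod.mk h ⁻¹' B) := measurable_prodMk_left hB
    have key : ∀ K : α → Bool → Θ → ℝ, (∀ h b, Integrable (K h b) ν) → ∀ b,
        ∫ ω in (fun ω => (W ω, θ ω)) ⁻¹' B ∩ {ω | W ω = h ∧ q ω = b}, K (W ω) (q ω) (θ ω) ∂μ =
          jointMass μ W q h b * ∫ x in Prod.mk h ⁻¹' B, K h b x ∂ν := fun K hK b => by
      rw [← setIntegral_atom hθ hind h b (hK h b) hBh]
      have hset : (fun ω => (W ω, θ ω)) ⁻¹' B ∩ {ω | W ω = h ∧ q ω = b} =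
          θ ⁻¹' (Prod.mk h ⁻¹' B) ∩ {ω | W ω = h ∧ q ω = b} := by
        ext ω
        simp only [Set.mem_inter_iff, Set.mem_preimage, Set.mem_ofPred_eq, and_congr_left_iff]
        rintro ⟨rfl, -⟩
        rfl
      rw [hset]
      refine setIntegral_congr_fun ((hθ hBh).inter (measurableSet_atom hW hq (h, b)))
        fun ω hω => ?_
      obtain ⟨-, h1, h2⟩ := hω
      simp only [h1, h2]
    rw [Fintype.sum_bool, Fintype.sum_bool, key F hF, key F hF, key (fun _ => g) fun _ => hg,
      key (fun _ => g) fun _ => hg]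
    have hI : ∀ b, ∫ x in Prod.mk h ⁻¹' B, F h b x ∂ν =
        (1 - jointBelief μ W q h) * ∫ x in Prod.mk h ⁻¹' B, g false x ∂ν +
          jointBelief μ W q h * ∫ x in Prod.mk h ⁻¹' B, g true x ∂ν := fun b => by
      rw [integral_add ((hg false).const_mul _).integrableOn ((hg true).const_mul _).integrableOn,
        integral_const_mul, integral_const_mul]
    have hI1 := hI true
    have hI2 := hI false
    simp only [F] at hI1 hI2 ⊢
    rw [hI1]
    obtain ⟨j1, j2⟩ := jointBelief_mul (μ := μ) W q h
    set a := jointMass μ W q h true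
    set b := jointMass μ W q h false
    linear_combination (-(∫ x in Prod.mk h ⁻¹' B, g true x ∂ν)) * j1 -
      (∫ x in Prod.mk h ⁻¹' B, g false x ∂ν) * j2
  · have hG : Measurable fun i : α × Θ =>
        (1 - jointBelief μ W q i.1) * g false i.2 + jointBelief μ W q i.1 * g true i.2 := by
      have hp : Measurable fun i : α × Θ => jointBelief μ W q i.1 :=
        (measurable_of_finite (jointBelief μ W q)).comp measurable_fst
      exact ((measurable_const.sub hp).mul ((hgm false).comp measurable_snd)).add
        (hp.mul ((hgm true).comp measurable_snd))
    exact (hG.comp (comap_measurable _)).aestronglyMeasurable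

/-- The conditional mean of the quality given `W`. -/
theorem condExp_value_eq (hW : ∀ h, MeasurableSet (W ⁻¹' {h})) (hq : Measurable q) :
    (fun ω => jointBelief μ W q (W ω)) =ᵐ[μ]
      μ[fun ω => value (q ω) | MeasurableSpace.comap W ⊤] := by
  -- Special case of Bayes' rule with a one-point preference space, whose σ-algebra adds no
  -- information.
  have hind : IndepOfAtoms μ (Measure.dirac ()) W q (fun _ => ()) := by
    intro h b B _
    by_cases hB : () ∈ B
    · have : B = Set.univ := Set.eq_univ_of_forall fun _ => hB
      simp [this, jointMass]
    · have : B = ∅ := Set.eq_empty_of_forall_notMem fun _ => hB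
      simp [this]
  have := condExp_eq_of_indepOfAtoms (g := fun b _ => value b) hW hq measurable_const hind
    (fun _ => measurable_const) (fun _ => integrable_const _)
  simpa [value, MeasurableSpace.comap_const] using this

/-- The mean error of the conditional mean of the quality given `W`. -/
theorem integral_norm_condExp_sub (hW : ∀ h, MeasurableSet (W ⁻¹' {h})) (hq : Measurable q) :
    ∫ ω, ‖(μ[fun ω' => value (q ω') | MeasurableSpace.comap W ⊤]) ω - value (q ω)‖ ∂μ =
      ∑ h, err (jointMass μ W q h true) (jointMass μ W q h false) := by
  have h1 : ∫ ω, ‖(μ[fun ω' => value (q ω') | MeasurableSpace.comap W ⊤]) ω - value (q ω)‖ ∂μ =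
      ∫ ω, ‖jointBelief μ W q (W ω) - value (q ω)‖ ∂μ := by
    refine integral_congr_ae ?_
    filter_upwards [condExp_value_eq (μ := μ) hW hq] with ω hω
    rw [← hω]
  rw [h1, integral_eq_sum_jointMass hW hq fun h b => ‖jointBelief μ W q h - value b‖]
  refine Finset.sum_congr rfl fun h _ => ?_
  obtain ⟨p0, p1⟩ := jointBelief_mem (μ := μ) W q h
  obtain ⟨j1, j2⟩ := jointBelief_mul (μ := μ) W q h
  have e : err (jointMass μ W q h true) (jointMass μ W q h false) =
      (jointMass μ W q h true + jointMass μ W q h false) *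
        (2 * (jointBelief μ W q h * (1 - jointBelief μ W q h))) := by
    rw [← err_one_sub, ← err_mul, ← j1, ← j2]
  rw [e]
  simp only [value, if_true, Bool.false_eq_true, if_false, sub_zero, Real.norm_eq_abs]
  rw [abs_of_nonneg p0, abs_of_nonpos (by linarith)]
  -- At belief `p`, the distance to the quality is `1 - p` with probability `p` and `p` with
  -- probability `1 - p`: hence `2p(1-p)`.
  linear_combination (1 - jointBelief μ W q h) * j1 + jointBelief μ W q h * j2

end FiniteConditioning

/-! ### Laws of the coins and of a single review -/

theorem coinLaw_true {p : ℝ} (h0 : 0 ≤ p) : (coinLaw p).real {true} = p := by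
  simp [coinLaw, measureReal_def, h0]

theorem coinLaw_false {p : ℝ} (h1 : p ≤ 1) : (coinLaw p).real {false} = 1 - p := by
  simp [coinLaw, measureReal_def, h1]

theorem isProbabilityMeasure_coinLaw {p : ℝ} (h0 : 0 ≤ p) (h1 : p ≤ 1) :
    IsProbabilityMeasure (coinLaw p) := by
  constructor
  simp only [coinLaw, Measure.add_apply, Measure.smul_apply, measure_univ, smul_eq_mul, mul_one]
  rw [← ENNReal.ofReal_add h0 (by linarith)]
  simp

instance : IsProbabilityMeasure prior := isProbabilityMeasure_coinLaw (by norm_num) (by norm_num)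

theorem prior_real_singleton (q : Quality) : prior.real {q} = 1 / 2 := by
  cases q
  · exact (coinLaw_false (by norm_num)).trans (by norm_num)
  · exact coinLaw_true (by norm_num)

namespace Market

variable {Θ E F : Type*} [MeasurableSpace Θ] [MeasurableSpace E] (M : Market Θ E F)

instance : IsProbabilityMeasure M.prefLaw := M.prefLaw_prob

instance : IsProbabilityMeasure M.noiseLaw := M.noiseLaw_prob

/-- The joint law of a preference and a noise. -/
def shockLaw : Measure (Θ × E) := M.prefLaw.prod M.noiseLaw

instance : IsProbabilityMeasure M.shockLaw := by unfold shockLaw; infer_instance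

open Classical in
/-- The review of a consumer with belief `p`. -/
def outcome (p : ℝ) (q : Quality) (x : Θ × E) : Option F :=
  if 0 < M.expectedReward p x.1 then some (M.feedback q x.1 x.2) else none

/-- The law of the review of a consumer with belief `p`. -/
def kern (o : Option F) (p : ℝ) (q : Quality) : ℝ := M.shockLaw.real {x | M.outcome p q x = o}

theorem measurable_expectedReward (p : ℝ) : Measurable (M.expectedReward p) :=
  ((M.reward_measurable L).const_mul _).add ((M.reward_measurable H).const_mul _)

theorem outcome_eq_some_iff {p : ℝ} {q : Quality} {x : Θ × E} {z : F} :
    M.outcome p q x = some z ↔ 0 < M.expectedReward p x.1 ∧ M.feedback q x.1 x.2 = z := by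
  unfold outcome; split_ifs with h <;> simp [h]

theorem outcome_eq_none_iff {p : ℝ} {q : Quality} {x : Θ × E} :
    M.outcome p q x = none ↔ ¬ 0 < M.expectedReward p x.1 := by
  unfold outcome; split_ifs with h <;> simp [h]

theorem measurableSet_buy (p : ℝ) : MeasurableSet {x : Θ × E | 0 < M.expectedReward p x.1} :=
  measurableSet_lt measurable_const ((M.measurable_expectedReward p).comp measurable_fst)

theorem measurableSet_outcome (p : ℝ) (q : Quality) (o : Option F) :
    MeasurableSet {x | M.outcome p q x = o} := by
  cases o with
  | none =>
    simp only [outcome_eq_none_iff]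
    exact (M.measurableSet_buy p).compl
  | some z =>
    simp only [outcome_eq_some_iff]
    exact (M.measurableSet_buy p).inter (M.feedback_measurable q z)

theorem kern_some (z : F) (p : ℝ) (q : Quality) : M.kern (some z) p q = M.G z p q := by
  simp only [kern, outcome_eq_some_iff]; rfl

/-- The purchase decision depends on belief and preference only, so a refusal reveals nothing about
the quality. -/
theorem kern_none (p : ℝ) (q q' : Quality) : M.kern none p q = M.kern none p q' := by
  simp only [kern, outcome_eq_none_iff]

theorem kern_nonneg (o : Option F) (p : ℝ) (q : Quality) : 0 ≤ M.kern o p q := measureReal_nonneg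

theorem kern_le_one (o : Option F) (p : ℝ) (q : Quality) : M.kern o p q ≤ 1 := measureReal_le_one

theorem sum_kern [Fintype F] (p : ℝ) (q : Quality) : ∑ o, M.kern o p q = 1 := by
  have := sum_measureReal_preimage_singleton (μ := M.shockLaw) Finset.univ
    (f := M.outcome p q) (fun o _ => M.measurableSet_outcome p q o)
  rw [Finset.coe_univ, Set.preimage_univ, probReal_univ] at this
  exact this

variable {M}

theorem G_zero_le (hbuy : M.PurchaseGuarantee) {p : ℝ} (hp : 0 ≤ p) (z : F) (q : Quality) :
    M.G z 0 q ≤ M.G z p q := by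
  refine measureReal_mono fun x hx => ⟨hx.1.trans_le ?_, hx.2⟩
  have := hbuy.1 x.1
  simp only [expectedReward]
  nlinarith

/-- Identifiability is only pointwise in the belief. Monotone rewards make belief `0` the worst case
for `G`, and a minimum over finitely many pairs is then uniform. -/
theorem exists_le_G [Fintype F] (hbuy : M.PurchaseGuarantee) (hident : M.Identifiable) :
    ∃ γ, 0 < γ ∧ ∀ p ∈ Set.Icc (0 : ℝ) 1, ∀ z q, γ ≤ M.G z p q := by
  obtain ⟨hpos, z₀, -⟩ := hident 0 (by simp)
  have : Nonempty (F × Quality) := ⟨(z₀, L)⟩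
  obtain ⟨i, hi⟩ := Finite.exists_min fun i : F × Quality => M.G i.1 0 i.2
  exact ⟨_, hpos i.1 i.2, fun p hp z q => (hi (z, q)).trans (G_zero_le hbuy hp.1 z q)⟩

theorem delta_le [Fintype F] {p : ℝ} (hp : p ∈ Set.Icc (0 : ℝ) 1) :
    M.delta ≤ ∑ z : F, |M.G z p L - M.G z p H| := by
  refine ciInf_le (f := fun p : Set.Icc (0 : ℝ) 1 => ∑ z : F, |M.G z p L - M.G z p H|)
    ⟨0, ?_⟩ ⟨p, hp⟩
  rintro _ ⟨p, rfl⟩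
  exact Finset.sum_nonneg fun _ _ => abs_nonneg _

/-- Cauchy–Schwarz, turning the `ℓ¹` gap into the `ℓ²` gap that governs information. -/
theorem delta_sq_le [Fintype F] (hdelta : 0 < M.delta) {p : ℝ} (hp : p ∈ Set.Icc (0 : ℝ) 1) :
    M.delta ^ 2 ≤ Fintype.card F * ∑ z : F, (M.G z p H - M.G z p L) ^ 2 := by
  have h1 := sq_sum_le_card_mul_sum_sq (s := Finset.univ) (f := fun z => |M.G z p L - M.G z p H|)
  have h2 := pow_le_pow_left₀ hdelta.le (delta_le hp) 2
  refine h2.trans (h1.trans_eq ?_)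
  simp only [sq_abs, Finset.card_univ]
  congr 1
  exact Finset.sum_congr rfl fun _ _ => by ring

/-! ### Information carried by a review -/

section Posterior

variable [Fintype F] (M)

/-- The mean entropy after a review. -/
def posteriorEnt (p x y : ℝ) : ℝ := ∑ o, ent (x * M.kern o p H) (y * M.kern o p L)

theorem posteriorEnt_mul (m p x y : ℝ) :
    M.posteriorEnt p (m * x) (m * y) = m * M.posteriorEnt p x y := by
  simp only [posteriorEnt, mul_assoc, ent_mul, Finset.mul_sum]

theorem sum_kern_mul (p : ℝ) :
    ∑ o, (M.kern o p H * Real.negMulLog p + M.kern o p L * Real.negMulLog (1 - p)) =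
      ent p (1 - p) := by
  rw [Finset.sum_add_distrib, ← Finset.sum_mul, ← Finset.sum_mul, M.sum_kern, M.sum_kern,
    ent_one_sub]
  ring

theorem sum_option_kern_sq (p : ℝ) :
    ∑ o, (M.kern o p H - M.kern o p L) ^ 2 = ∑ z, (M.G z p H - M.G z p L) ^ 2 := by
  rw [Fintype.sum_option, M.kern_none p H L]
  simp [kern_some]

variable {M}

theorem posteriorEnt_one_sub_le (hident : M.Identifiable) {p : ℝ} (h0 : 0 < p) (h1 : p < 1) :
    M.posteriorEnt p p (1 - p) ≤
      ent p (1 - p) - (∑ z, (M.G z p H - M.G z p L) ^ 2) / 4 * (p * (1 - p)) := by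
  rw [← M.sum_option_kern_sq, ← M.sum_kern_mul, Finset.sum_div, Finset.sum_mul,
    ← Finset.sum_sub_distrib]
  refine Finset.sum_le_sum fun o _ => ?_
  cases o with
  | none =>
    rw [M.kern_none p H L, ent_posterior_self]
    simp
  | some z =>
    have hpos := (hident p ⟨h0.le, h1.le⟩).1 z
    exact ent_posterior_le h0 h1 (by rw [kern_some]; exact hpos H)
      (by rw [kern_some]; exact hpos L) (M.kern_le_one _ _ _) (M.kern_le_one _ _ _)

theorem le_posteriorEnt_one_sub {γ p : ℝ} (hγ : 0 < γ)
    (hG : ∀ p ∈ Set.Icc (0 : ℝ) 1, ∀ z q, γ ≤ M.G z p q) (h0 : 0 < p) (h1 : p < 1) :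
    ent p (1 - p) - (∑ z, (M.G z p H - M.G z p L) ^ 2) / γ * (p * (1 - p)) ≤
      M.posteriorEnt p p (1 - p) := by
  rw [← M.sum_option_kern_sq, ← M.sum_kern_mul, Finset.sum_div, Finset.sum_mul,
    ← Finset.sum_sub_distrib]
  refine Finset.sum_le_sum fun o _ => ?_
  cases o with
  | none =>
    rw [M.kern_none p H L, ent_posterior_self]
    simp
  | some z =>
    have hpos := hG p ⟨h0.le, h1.le⟩ z
    exact le_ent_posterior h0 h1 hγ (by rw [kern_some]; exact hpos H)
      (by rw [kern_some]; exact hpos L)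

/-- The mean entropy decreases at each review by the order of the error. -/
theorem exists_posteriorEnt_bounds (hbuy : M.PurchaseGuarantee) (hident : M.Identifiable)
    (hdelta : 0 < M.delta) :
    ∃ c C : ℝ, 0 < c ∧ 0 < C ∧ ∀ x y : ℝ, 0 < x → 0 < y →
      M.posteriorEnt (x / (x + y)) x y ≤ ent x y - c * err x y ∧
      ent x y - C * err x y ≤ M.posteriorEnt (x / (x + y)) x y := by
  obtain ⟨γ, hγ, hG⟩ := exists_le_G hbuy hident
  obtain ⟨-, z₀, -⟩ := hident 0 (by simp)
  have : Nonempty F := ⟨z₀⟩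
  have hF : (0 : ℝ) < Fintype.card F := by exact_mod_cast Fintype.card_pos
  -- The squared gap `S` lies between `δ²/|F|` and `|F|`, and the information between `S/4` and
  -- `S/γ` times `p(1-p)`; the error being `2p(1-p)` adds a factor 2.
  refine ⟨M.delta ^ 2 / (8 * Fintype.card F), Fintype.card F / (2 * γ), by positivity,
    by positivity, fun x y hx hy => ?_⟩
  have hxy : 0 < x + y := by positivity
  obtain ⟨s1, s2⟩ := exists_scale hxy
  have hpost : M.posteriorEnt (x / (x + y)) x y =
      (x + y) * M.posteriorEnt (x / (x + y)) (x / (x + y)) (1 - x / (x + y)) := by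
    rw [← posteriorEnt_mul, ← s1, ← s2]
  rw [hpost, ent_eq_scale hxy, err_eq_scale hxy, err_one_sub]
  have hp0 : 0 < x / (x + y) := by positivity
  have hp1 : x / (x + y) < 1 := by rw [div_lt_one hxy]; linarith
  set p := x / (x + y)
  have hv : 0 ≤ p * (1 - p) := mul_nonneg hp0.le (by linarith)
  have hp : p ∈ Set.Icc (0 : ℝ) 1 := ⟨hp0.le, hp1.le⟩
  set S := ∑ z, (M.G z p H - M.G z p L) ^ 2 with hS
  have hS1 : M.delta ^ 2 / Fintype.card F ≤ S := by
    rw [div_le_iff₀' hF]; exact delta_sq_le hdelta hp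
  have hS2 : S ≤ Fintype.card F := by
    have : S ≤ ∑ _z : F, (1 : ℝ) := Finset.sum_le_sum fun z _ => by
      rw [← kern_some, ← kern_some]
      have a1 := M.kern_nonneg (some z) p H
      have a2 := M.kern_nonneg (some z) p L
      have a3 := M.kern_le_one (some z) p H
      have a4 := M.kern_le_one (some z) p L
      rw [sq_le_one_iff_abs_le_one, abs_le]
      constructor <;> linarith
    simpa using this
  have b1 := posteriorEnt_one_sub_le hident hp0 hp1
  have b2 := le_posteriorEnt_one_sub hγ hG hp0 hp1
  rw [← hS] at b1 b2
  constructor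
  · have h : M.delta ^ 2 / (8 * Fintype.card F) * (2 * (p * (1 - p))) ≤ S / 4 * (p * (1 - p)) := by
      rw [show M.delta ^ 2 / (8 * (Fintype.card F : ℝ)) * (2 * (p * (1 - p))) =
        M.delta ^ 2 / Fintype.card F / 4 * (p * (1 - p)) by field_simp; ring]
      gcongr
    have := mul_le_mul_of_nonneg_left (b1.trans (sub_le_sub_left h _)) hxy.le
    linarith
  · have h : S / γ * (p * (1 - p)) ≤ Fintype.card F / (2 * γ) * (2 * (p * (1 - p))) := by
      rw [show (Fintype.card F : ℝ) / (2 * γ) * (2 * (p * (1 - p))) =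
        Fintype.card F / γ * (p * (1 - p)) by field_simp]
      gcongr
    have := mul_le_mul_of_nonneg_left ((sub_le_sub_left h _).trans b2) hxy.le
    linarith

end Posterior

end Market

/-! ### Measurability, and independence from the past -/

namespace Inputs

variable {Θ E F : Type*} [MeasurableSpace Θ] [MeasurableSpace E] {M : Market Θ E F} {η : ℝ}
  {Ω : Type*} [MeasurableSpace Ω] {μ : Measure Ω} (I : Inputs M η μ)

/-- The inputs of time `t`. -/
def draw (t : ℕ) (ω : Ω) : Quality × Bool × Θ × E := (I.X t ω, I.S t ω, I.θ t ω, I.ε t ω)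

/-- The preference and the noise of time `t`. -/
def shock (t : ℕ) (ω : Ω) : Θ × E := (I.θ t ω, I.ε t ω)

theorem measurable_draw (t : ℕ) : Measurable (I.draw t) :=
  (I.X_measurable t).prodMk ((I.S_measurable t).prodMk
    ((I.θ_measurable t).prodMk (I.ε_measurable t)))

/-- The information of the inputs up to time `t`. -/
@[reducible] def past (t : ℕ) : MeasurableSpace Ω :=
  ⨆ i ∈ Set.Iic t, MeasurableSpace.comap (I.draw i) inferInstance

theorem past_le (t : ℕ) : I.past t ≤ ‹MeasurableSpace Ω› :=
  iSup₂_le fun i _ => (I.measurable_draw i).comap_le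

theorem past_mono {s t : ℕ} (h : s ≤ t) : I.past s ≤ I.past t :=
  biSup_mono fun _ hi => le_trans (Set.mem_Iic.1 hi) h

theorem measurable_past_draw (t : ℕ) : Measurable[I.past t] (I.draw t) :=
  Measurable.mono (comap_measurable _)
    (le_iSup₂_of_le (f := fun i (_ : i ∈ Set.Iic t) =>
      MeasurableSpace.comap (I.draw i) inferInstance) t (Set.mem_Iic.2 le_rfl) le_rfl) le_rfl

theorem measurable_past_Q (t : ℕ) : Measurable[I.past t] (I.Q t) := by
  induction t with
  | zero => exact measurable_fst.comp (I.measurable_past_draw 0)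
  | succ t ih =>
    have h1 := I.measurable_past_draw (t + 1)
    have hX : Measurable[I.past (t + 1)] (I.X (t + 1)) := measurable_fst.comp h1
    have hS : Measurable[I.past (t + 1)] (I.S (t + 1)) :=
      measurable_fst.comp (measurable_snd.comp h1)
    have hQ : Measurable[I.past (t + 1)] (I.Q t) := ih.mono (I.past_mono t.le_succ) le_rfl
    exact Measurable.ite (hS (measurableSet_singleton true)) hX hQ

theorem measurable_past_shock (t : ℕ) : Measurable[I.past t] (I.shock t) :=
  (measurable_snd.comp measurable_snd).comp (I.measurable_past_draw t)

theorem history_le_past {t : ℕ}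
    (h : ∀ s < t, Measurable[I.past s, ⊤] (I.review s)) : I.history t ≤ I.past t :=
  iSup_le fun s => ((h s.1 s.2.2).mono (I.past_mono s.2.2.le) le_rfl).comap_le

theorem measurable_past_review [Fintype F] (t : ℕ) : Measurable[I.past t, ⊤] (I.review t) := by
  induction t using Nat.strong_induction_on with
  | _ t ih =>
    have hm : I.history t ⊔ MeasurableSpace.comap (I.θ t) inferInstance ≤ I.past t :=
      sup_le (I.history_le_past ih) (measurable_fst.comp (I.measurable_past_shock t)).comap_le
    have hc := (stronglyMeasurable_condExp (μ := μ)
      (f := fun ω' => M.reward (I.Q t ω') (I.θ t ω'))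
      (m := I.history t ⊔ MeasurableSpace.comap (I.θ t) inferInstance)).measurable
    have hpos := hc (measurableSet_Ioi (a := (0 : ℝ)))
    have hbuy := hm _ hpos
    have hQ := I.measurable_past_Q t
    have hS := I.measurable_past_shock t
    let _ : MeasurableSpace (Option F) := ⊤
    have : MeasurableSingletonClass (Option F) := ⟨fun _ => trivial⟩
    refine @measurable_to_countable' _ _ _ _ (I.past t) _ fun o => ?_
    cases o with
    | none =>
      convert! hbuy.compl using 1
      ext ω
      simp only [Set.mem_preimage, Set.mem_singleton_iff, Set.mem_compl_iff, Set.mem_Ioi]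
      rw [review_eq]
      split_ifs with h <;> simp [h]
    | some z =>
      have hz : MeasurableSet[I.past t]
          -- Feedback is measurable for each fixed quality, so the event is split along the two
          -- qualities.
          (⋃ q, I.Q t ⁻¹' {q} ∩ I.shock t ⁻¹' {x | M.feedback q x.1 x.2 = z}) :=
        MeasurableSet.iUnion fun q => (hQ (measurableSet_singleton q)).inter
          (hS (M.feedback_measurable q z))
      convert! hbuy.inter hz using 1
      ext ω
      simp only [Set.mem_preimage, Set.mem_singleton_iff, Set.mem_inter_iff, Set.mem_Ioi,
        Set.mem_iUnion]
      rw [review_eq]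
      split_ifs with h <;> simp [h, shock]

/-- The reviews of times `1, …, n`. -/
def record (n : ℕ) (ω : Ω) (i : Fin n) : Option F := I.review (i + 1) ω

theorem measurableSet_past_record [Fintype F] (n : ℕ) (h : Fin n → Option F) :
    MeasurableSet[I.past n] (I.record n ⁻¹' {h}) := by
  have : I.record n ⁻¹' {h} = ⋂ i : Fin n, I.review (i + 1) ⁻¹' {h i} := by
    ext ω
    simp [funext_iff, record]
  rw [this]
  exact MeasurableSet.iInter fun i =>
    I.past_mono (by omega : (i : ℕ) + 1 ≤ n) _ (I.measurable_past_review (i + 1) trivial)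

theorem measurableSet_record [Fintype F] (n : ℕ) (h : Fin n → Option F) :
    MeasurableSet (I.record n ⁻¹' {h}) :=
  I.past_le n _ (I.measurableSet_past_record n h)

theorem measurable_Q (t : ℕ) : Measurable (I.Q t) :=
  (I.measurable_past_Q t).mono (I.past_le t) le_rfl

/-- Consumer `n + 1` sees exactly `n` reviews; a finite-valued vector generates the history, which
reduces conditioning to finite sums. -/
theorem history_eq_comap_record [Fintype F] (n : ℕ) :
    I.history (n + 1) = MeasurableSpace.comap (I.record n) ⊤ := by
  apply le_antisymm
  · refine iSup_le fun ⟨s, hs1, hs2⟩ => ?_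
    have : I.review s = (fun h : Fin n → Option F => h ⟨s - 1, by omega⟩) ∘ I.record n := by
      funext ω
      simp [record, Nat.sub_add_cancel hs1]
    rw [this, ← MeasurableSpace.comap_comp]
    exact MeasurableSpace.comap_mono le_top
  · rw [← measurable_iff_comap_le]
    let _ : MeasurableSpace (Fin n → Option F) := ⊤
    refine @measurable_to_countable' _ _ _ _ (I.history (n + 1)) _ fun h => ?_
    have : I.record n ⁻¹' {h} = ⋂ i : Fin n, I.review (i + 1) ⁻¹' {h i} := by
      ext ω
      simp [funext_iff, record]
    rw [this]
    refine MeasurableSet.iInter fun i => ?_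
    exact le_iSup (fun s : {s : ℕ // 1 ≤ s ∧ s < n + 1} =>
      MeasurableSpace.comap (I.review s.1) ⊤) ⟨i + 1, by omega, by omega⟩ _ ⟨{h i}, trivial, rfl⟩

theorem measureReal_inter_draw (n : ℕ) {A : Set Ω} (hA : MeasurableSet[I.past n] A)
    {C : Set (Quality × Bool × Θ × E)} (hC : MeasurableSet C) :
    μ.real (A ∩ I.draw (n + 1) ⁻¹' C) =
      μ.real A * (prior.prod ((coinLaw η).prod M.shockLaw)).real C := by
  have hind : Indep (I.past n)
      (⨆ i ∈ ({n + 1} : Set ℕ), MeasurableSpace.comap (I.draw i) inferInstance) μ :=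
    indep_iSup_of_disjoint (fun i => (I.measurable_draw i).comap_le) I.indep
      (Set.disjoint_singleton_right.2 (by simp))
  rw [iSup_singleton] at hind
  have h := (Indep_iff _ _ _).1 hind A _ hA ⟨C, hC, rfl⟩
  have hlaw : μ (I.draw (n + 1) ⁻¹' C) = (prior.prod ((coinLaw η).prod M.shockLaw)) C := by
    rw [← Measure.map_apply (I.measurable_draw (n + 1)) hC]
    exact congrArg (fun ν : Measure _ => ν C) (I.law (n + 1))
  rw [measureReal_def, h, hlaw, ENNReal.toReal_mul]
  rfl

/-! ### Joint masses and evolution of the mean entropy -/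

/-- The joint law of `(Z_1, …, Z_n)` and `Q_t`. -/
def mass (n t : ℕ) (h : Fin n → Option F) (q : Quality) : ℝ :=
  jointMass μ (I.record n) (I.Q t) h q

/-- The belief of consumer `n + 1`. -/
def belief (n : ℕ) (h : Fin n → Option F) : ℝ := jointBelief μ (I.record n) (I.Q (n + 1)) h

theorem mass_nonneg (n t : ℕ) (h : Fin n → Option F) (q : Quality) : 0 ≤ I.mass n t h q :=
  measureReal_nonneg

theorem measureReal_record [IsProbabilityMeasure μ] (n : ℕ) (h : Fin n → Option F) (q : Quality) :
    μ.real (I.record n ⁻¹' {h}) = I.mass n n h q + I.mass n n h (!q) := by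
  have hq : MeasurableSet (I.Q n ⁻¹' {q}) := I.measurable_Q n (measurableSet_singleton q)
  rw [← measureReal_inter_add_sdiff hq]
  congr 1
  simp only [mass, jointMass]
  congr 1
  ext ω
  cases q <;> simp

variable [Fintype F]

/-- The mean entropy of `Q_t` given `(Z_1, …, Z_n)`. -/
def meanEnt (n t : ℕ) : ℝ := ∑ h, ent (I.mass n t h H) (I.mass n t h L)

theorem meanEnt_nonneg (n t : ℕ) : 0 ≤ I.meanEnt n t :=
  Finset.sum_nonneg fun _ _ => ent_nonneg (I.mass_nonneg _ _ _ _) (I.mass_nonneg _ _ _ _)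

/-- The potential starts at its maximum, so the lower bound on the loss has no additive term to
absorb. -/
theorem meanEnt_zero (h0 : 0 ≤ η) (h1 : η ≤ 1) : I.meanEnt 0 0 = Real.log 2 := by
  have key : ∀ h q, I.mass 0 0 h q = 1 / 2 := fun h q => by
    have : IsProbabilityMeasure (coinLaw η) := isProbabilityMeasure_coinLaw h0 h1
    have e : {ω | I.record 0 ω = h ∧ I.Q 0 ω = q} =
        I.draw 0 ⁻¹' ({q} ×ˢ Set.univ) := by
      ext ω
      simp [Q, draw, eq_iff_true_of_subsingleton]
    rw [mass, jointMass, e, ← map_measureReal_apply (I.measurable_draw 0) (by measurability)]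
    have : μ.map (I.draw 0) = prior.prod ((coinLaw η).prod M.shockLaw) := I.law 0
    rw [this, measureReal_prod_prod, prior_real_singleton, probReal_univ, mul_one]
  rw [meanEnt, Fintype.sum_unique, key, key, ent_half]

variable [IsProbabilityMeasure μ]

/-- Split on the coin: either a fresh uniform quality is drawn, or `Q n` is kept. The event `D` is
carried along to show that the new shock is independent of record and quality. -/
theorem measureReal_redraw (h0 : 0 ≤ η) (h1 : η ≤ 1) (n : ℕ) (h : Fin n → Option F) (q : Quality)
    {D : Set (Θ × E)} (hD : MeasurableSet D) :
    μ.real ({ω | I.record n ω = h ∧ I.Q (n + 1) ω = q} ∩ I.shock (n + 1) ⁻¹' D) =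
      redraw η (I.mass n n h q) (I.mass n n h (!q)) * M.shockLaw.real D := by
  have : IsProbabilityMeasure (coinLaw η) := isProbabilityMeasure_coinLaw h0 h1
  have hW := I.measurableSet_past_record n h
  have hWQ : MeasurableSet[I.past n] {ω | I.record n ω = h ∧ I.Q n ω = q} :=
    hW.inter (I.measurable_past_Q n (measurableSet_singleton q))
  have hS : MeasurableSet {ω | I.S (n + 1) ω = true} :=
    I.S_measurable (n + 1) (measurableSet_singleton true)
  rw [← measureReal_inter_add_sdiff hS]
  have e1 : {ω | I.record n ω = h ∧ I.Q (n + 1) ω = q} ∩ I.shock (n + 1) ⁻¹' D ∩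
      {ω | I.S (n + 1) ω = true} =
      I.record n ⁻¹' {h} ∩ I.draw (n + 1) ⁻¹' ({q} ×ˢ {true} ×ˢ D) := by
    ext ω
    by_cases hs : I.S (n + 1) ω = true <;> simp [Q, draw, shock, hs]
    tauto
  have e2 : ({ω | I.record n ω = h ∧ I.Q (n + 1) ω = q} ∩ I.shock (n + 1) ⁻¹' D) \
      {ω | I.S (n + 1) ω = true} =
      {ω | I.record n ω = h ∧ I.Q n ω = q} ∩
        I.draw (n + 1) ⁻¹' (Set.univ ×ˢ {false} ×ˢ D) := by
    ext ω
    by_cases hs : I.S (n + 1) ω = true <;> simp [Q, draw, shock, hs]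
  rw [e1, e2, I.measureReal_inter_draw n hW (by measurability),
    I.measureReal_inter_draw n hWQ (by measurability), measureReal_prod_prod,
    measureReal_prod_prod, measureReal_prod_prod, measureReal_prod_prod, coinLaw_true h0,
    coinLaw_false h1, prior_real_singleton, probReal_univ, I.measureReal_record n h q]
  simp only [redraw, mass, jointMass]
  ring

theorem mass_redraw (h0 : 0 ≤ η) (h1 : η ≤ 1) (n : ℕ) (h : Fin n → Option F) (q : Quality) :
    I.mass n (n + 1) h q = redraw η (I.mass n n h q) (I.mass n n h (!q)) := by
  have := I.measureReal_redraw h0 h1 n h q MeasurableSet.univ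
  rw [Set.preimage_univ, Set.inter_univ, probReal_univ, mul_one] at this
  exact this

theorem indepOfAtoms_shock (h0 : 0 ≤ η) (h1 : η ≤ 1) (n : ℕ) :
    IndepOfAtoms μ M.shockLaw (I.record n) (I.Q (n + 1)) (I.shock (n + 1)) := fun h q D hD => by
  rw [I.measureReal_redraw h0 h1 n h q hD, ← I.mass_redraw h0 h1]
  rfl

theorem indepOfAtoms_θ (h0 : 0 ≤ η) (h1 : η ≤ 1) (n : ℕ) :
    IndepOfAtoms μ M.prefLaw (I.record n) (I.Q (n + 1)) (I.θ (n + 1)) := fun h q B hB => by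
  have := I.indepOfAtoms_shock h0 h1 n h q (B ×ˢ Set.univ) (hB.prod MeasurableSet.univ)
  rw [Market.shockLaw, measureReal_prod_prod, probReal_univ, mul_one] at this
  rw [← this]
  congr 2
  ext ω
  simp [shock]

/-- Consumers act on their beliefs. -/
theorem review_ae_eq (h0 : 0 ≤ η) (h1 : η ≤ 1) (n : ℕ) :
    ∀ᵐ ω ∂μ, I.review (n + 1) ω =
      M.outcome (I.belief n (I.record n ω)) (I.Q (n + 1) ω) (I.shock (n + 1) ω) := by
  have := condExp_eq_of_indepOfAtoms (I.measurableSet_record n) (I.measurable_Q (n + 1))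
    (I.θ_measurable (n + 1)) (I.indepOfAtoms_θ h0 h1 n) M.reward_measurable M.reward_integrable
  filter_upwards [this] with ω hω
  rw [review_eq, I.history_eq_comap_record, ← hω]
  rfl

/-- Filtering step: on the atom of `h` the belief is a constant, and the shock is independent of
record and quality. The events agree only almost everywhere, since purchases are defined by a
conditional expectation. -/
theorem mass_snoc (h0 : 0 ≤ η) (h1 : η ≤ 1) (n : ℕ) (h : Fin n → Option F) (o : Option F)
    (q : Quality) :
    I.mass (n + 1) (n + 1) (Fin.snoc h o : Fin (n + 1) → Option F) q =
      I.mass n (n + 1) h q * M.kern o (I.belief n h) q := by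
  have hD := M.measurableSet_outcome (I.belief n h) q o
  have e := I.indepOfAtoms_shock h0 h1 n h q _ hD
  rw [mass, Market.kern, mass, ← e, jointMass]
  refine measureReal_congr ?_
  filter_upwards [I.review_ae_eq h0 h1 n] with ω hω
  have hrec : I.record (n + 1) ω =
      (Fin.snoc (I.record n ω) (I.review (n + 1) ω) : Fin (n + 1) → Option F) := by
    funext i
    refine Fin.lastCases ?_ (fun i => ?_) i <;> simp [record]
  apply propext
  change (I.record (n + 1) ω = Fin.snoc h o ∧ I.Q (n + 1) ω = q) ↔
    ((I.record n ω = h ∧ I.Q (n + 1) ω = q) ∧ M.outcome (I.belief n h) q (I.shock (n + 1) ω) = o)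
  rw [hrec, Fin.snoc_inj, hω]
  constructor
  · rintro ⟨⟨rfl, rfl⟩, rfl⟩
    exact ⟨⟨rfl, rfl⟩, rfl⟩
  · rintro ⟨⟨rfl, rfl⟩, rfl⟩
    exact ⟨⟨rfl, rfl⟩, rfl⟩

/-- The mean error of the belief of consumer `n + 1`. -/
def meanErr (n : ℕ) : ℝ := ∑ h, err (I.mass n (n + 1) h H) (I.mass n (n + 1) h L)

theorem sum_mass (n t : ℕ) : ∑ h, (I.mass n t h H + I.mass n t h L) = 1 :=
  sum_jointMass (I.measurableSet_record n) (I.measurable_Q t)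

theorem loss_eq_sum_meanErr (T : ℕ) : I.loss T = ∑ n ∈ Finset.range T, I.meanErr n := by
  induction T with
  | zero => simp [loss]
  | succ T ih =>
    rw [loss, Finset.sum_Icc_succ_top (by omega), Finset.sum_range_succ, ← ih,
      I.history_eq_comap_record T]
    congr 1
    exact integral_norm_condExp_sub (I.measurableSet_record T) (I.measurable_Q (T + 1))

theorem meanEnt_le (n t : ℕ) : I.meanEnt n t ≤ Real.log 2 := by
  rw [← one_mul (Real.log 2), ← I.sum_mass n t, Finset.sum_mul]
  exact Finset.sum_le_sum fun _ _ => ent_le (I.mass_nonneg _ _ _ _) (I.mass_nonneg _ _ _ _)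

theorem meanEnt_redraw_le (h0 : 0 < η) (h1 : η < 1 / 2) (n : ℕ) :
    I.meanEnt n (n + 1) ≤ I.meanEnt n n + 4 * (η * Real.log (1 / η)) := by
  have hs := congrArg (· * (4 * (η * Real.log (1 / η)))) (I.sum_mass n n)
  simp only [one_mul, Finset.sum_mul] at hs
  rw [← hs, meanEnt, meanEnt, ← Finset.sum_add_distrib]
  refine Finset.sum_le_sum fun h _ => ?_
  rw [I.mass_redraw h0.le (by linarith), I.mass_redraw h0.le (by linarith)]
  exact (ent_redraw_bounds h0 h1 (I.mass_nonneg n n h H) (I.mass_nonneg n n h L)).1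

theorem le_meanEnt_redraw (h0 : 0 < η) (h1 : η < 1 / 2) (n : ℕ) :
    I.meanEnt n n + 1 / 20 * (η * Real.log (1 / η)) ≤ I.meanEnt n (n + 1) + I.meanErr n := by
  have hs := congrArg (· * (1 / 20 * (η * Real.log (1 / η)))) (I.sum_mass n n)
  simp only [one_mul, Finset.sum_mul] at hs
  rw [← hs, meanEnt, meanEnt, meanErr, ← Finset.sum_add_distrib, ← Finset.sum_add_distrib]
  refine Finset.sum_le_sum fun h _ => ?_
  rw [I.mass_redraw h0.le (by linarith), I.mass_redraw h0.le (by linarith)]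
  exact (ent_redraw_bounds h0 h1 (I.mass_nonneg n n h H) (I.mass_nonneg n n h L)).2

theorem meanEnt_succ (h0 : 0 ≤ η) (h1 : η ≤ 1) (n : ℕ) :
    I.meanEnt (n + 1) (n + 1) =
      ∑ h, M.posteriorEnt (I.belief n h) (I.mass n (n + 1) h H) (I.mass n (n + 1) h L) := by
  rw [meanEnt, ← (Fin.snocEquiv fun _ : Fin (n + 1) => Option F).sum_comp,
    Fintype.sum_prod_type_right]
  refine Finset.sum_congr rfl fun h _ => Finset.sum_congr rfl fun o _ => ?_
  have := I.mass_snoc h0 h1 n h o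
  rw [← this, ← this]
  rfl

/-- The bounds on the loss of entropy at a review hold for every history. -/
theorem meanEnt_review_bounds (h0 : 0 < η) (h1 : η < 1 / 2) {c C : ℝ}
    (hM : ∀ x y : ℝ, 0 < x → 0 < y →
      M.posteriorEnt (x / (x + y)) x y ≤ ent x y - c * err x y ∧
      ent x y - C * err x y ≤ M.posteriorEnt (x / (x + y)) x y) (n : ℕ) :
    I.meanEnt (n + 1) (n + 1) ≤ I.meanEnt n (n + 1) - c * I.meanErr n ∧
      I.meanEnt n (n + 1) - C * I.meanErr n ≤ I.meanEnt (n + 1) (n + 1) := by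
  have key : ∀ h, M.posteriorEnt (I.belief n h) (I.mass n (n + 1) h H) (I.mass n (n + 1) h L) ≤
        ent (I.mass n (n + 1) h H) (I.mass n (n + 1) h L) -
          c * err (I.mass n (n + 1) h H) (I.mass n (n + 1) h L) ∧
      ent (I.mass n (n + 1) h H) (I.mass n (n + 1) h L) -
          C * err (I.mass n (n + 1) h H) (I.mass n (n + 1) h L) ≤
        M.posteriorEnt (I.belief n h) (I.mass n (n + 1) h H) (I.mass n (n + 1) h L) := fun h => by
    have hx := I.mass_nonneg n n h H
    have hy := I.mass_nonneg n n h L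
    have eH : I.mass n (n + 1) h H = redraw η (I.mass n n h H) (I.mass n n h L) :=
      I.mass_redraw h0.le (by linarith) n h H
    have eL : I.mass n (n + 1) h L = redraw η (I.mass n n h L) (I.mass n n h H) :=
      I.mass_redraw h0.le (by linarith) n h L
    -- Null histories contribute zero throughout. On the others the redraw makes both masses
    -- positive, as `hM` requires.
    rcases (add_nonneg hx hy).eq_or_lt with hz | hz
    · have hx0 : I.mass n n h H = 0 := by linarith
      have hy0 : I.mass n n h L = 0 := by linarith
      rw [eH, eL, hx0, hy0]
      simp [redraw, ent_zero, err_zero, Market.posteriorEnt]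
    · have pH : 0 < I.mass n (n + 1) h H := by
        rw [eH]; exact redraw_pos h0 h1 hx hz
      have pL : 0 < I.mass n (n + 1) h L := by
        rw [eL]; exact redraw_pos h0 h1 hy (by linarith)
      exact hM _ _ pH pL
  rw [I.meanEnt_succ h0.le (by linarith), meanEnt, meanErr, Finset.mul_sum, Finset.mul_sum,
    ← Finset.sum_sub_distrib, ← Finset.sum_sub_distrib]
  exact ⟨Finset.sum_le_sum fun h _ => (key h).1, Finset.sum_le_sum fun h _ => (key h).2⟩

end Inputs

end SocialLearning

end

/-! ### Telescoping over time -/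

theorem mainTheorem1 {Θ E F : Type*} [MeasurableSpace Θ] [MeasurableSpace E] [Fintype F]
    (M : SocialLearning.Market Θ E F) (hbuy : M.PurchaseGuarantee) (hident : M.Identifiable)
    (hdelta : 0 < M.delta) (c₀ : ℝ) (hc₀ : 0 < c₀) :
    ∃ c C : ℝ, 0 < c ∧ 0 < C ∧
      ∀ (η : ℝ) (T : ℕ), 0 < η → η < 1 / 2 → 1 ≤ T → c₀ ≤ η * T →
        ∀ (Ω : Type*) [MeasurableSpace Ω] (μ : Measure Ω) [IsProbabilityMeasure μ]
          (I : SocialLearning.Inputs M η μ),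
          c * (Real.log (1 / η) * η * T) ≤ I.loss T ∧
            I.loss T ≤ C * (Real.log (1 / η) * η * T) := by
  obtain ⟨a, A, ha, hA, hM⟩ := M.exists_posteriorEnt_bounds hbuy hident hdelta
  -- In the lower bound the error is charged once by the redraw and `A` times by the review. In the
  -- upper bound `2 / c₀` pays for the initial `log 2 ≤ 1`, as `log(1/η) > 1/2` and `ηT ≥ c₀`.
  refine ⟨1 / (20 * (1 + A)), (4 + 2 / c₀) / a, by positivity, by positivity, ?_⟩
  intro η T h0 h1 _ hT Ω _ μ _ I
  have hK0 := I.meanEnt_zero h0.le (by linarith)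
  have hb := I.meanEnt_review_bounds h0 h1 hM
  have hu : ∀ n : ℕ, a * ∑ k ∈ Finset.range n, I.meanErr k ≤
      Real.log 2 - I.meanEnt n n + n * (4 * (η * Real.log (1 / η))) := fun n => by
    induction n with
    | zero => simp [hK0]
    | succ n ih =>
      rw [Finset.sum_range_succ]
      have h2 := (hb n).1
      have h3 := I.meanEnt_redraw_le h0 h1 n
      push_cast
      linarith
  have hl : ∀ n : ℕ, Real.log 2 + n * (1 / 20 * (η * Real.log (1 / η))) ≤
      I.meanEnt n n + (1 + A) * ∑ k ∈ Finset.range n, I.meanErr k := fun n => by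
    induction n with
    | zero => simp [hK0]
    | succ n ih =>
      rw [Finset.sum_range_succ]
      have h2 := (hb n).2
      have h3 := I.le_meanEnt_redraw h0 h1 n
      push_cast
      linarith
  rw [I.loss_eq_sum_meanErr]
  have hlu := hu T
  have hll := hl T
  have e1 := I.meanEnt_nonneg T T
  have e2 := I.meanEnt_le T T
  have e3 := SocialLearning.half_lt_log_inv h0 h1
  have e4 : Real.log 2 ≤ 1 := by have := Real.log_two_lt_d9; linarith
  constructor
  · rw [div_mul_eq_mul_div, div_le_iff₀ (by positivity)]
    linarith
  · rw [div_mul_eq_mul_div, le_div_iff₀ ha]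
    have e5 : 1 ≤ 2 / c₀ * (Real.log (1 / η) * η * T) := by
      rw [div_mul_eq_mul_div, le_div_iff₀ hc₀]
      nlinarith
    linarith
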